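/- Let $\mathcal A$ be an associative unital $\mathbb C$-algebra and let $q\in\mathbb C\setminus\{0\}$. Write $\mathrm{SL}_2^q(\mathcal A)$ for the set of matrices $\begin{pmatrix} a&b\\c&d\end{pmatrix}$ with entries in $\mathcal A$ such that $$ba=q\,ab,\quad db=q\,bd,\quad bc=cb,\quad ca=q\,ac,\quad dc=q\,cd,\quad ad-q^{-1}bc=da-q\,bc,\quad ad-q^{-1}bc=1.$$ Let $T_n(t)\in\mathbb Z[t]$ be the normalized Chebyshev polynomials of the first kind, defined by $T_0(t)=2$, $T_1(t)=t$ and $T_{n+1}(t)=t\,T_n(t)-T_{n-1}(t)$. The trace of a $2\times2$ matrix is the sum of its diagonal entries. Let $A_1,\dots,A_k$ be $2\times 2$ matrices with entries in $\mathcal A$ such that 1. each $A_i$ is triangular, of the form $\begin{pmatrix} a_i&b_i\\0&a_i^{-1}\end{pmatrix}$ or $\begin{pmatrix} a_i&0\\b_i&a_i^{-1}\end{pmatrix}$, where $a_i\in\mathcal A$ is invertible, $b_i\in\mathcal A$ and $b_ia_i=q\,a_ib_i$ (with the same $q$ for all $i$); 2. $a_i$ and $b_i$ commute with $a_j$ and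 $b_j$ whenever $i\neq j$. Let $n\ge 1$ be such that $q^2$ is a primitive $n$-th root of unity, and let $A_i^{(n)}$ be the matrix obtained from $A_i$ by replacing $a_i$, $b_i$, $a_i^{-1}$ by $a_i^n$, $b_i^n$, $a_i^{-n}$. Then every $A_i$ and the product $A_1A_2\cdots A_k$ belong to $\mathrm{SL}_2^q(\mathcal A)$, every $A_i^{(n)}$ belongs to $\mathrm{SL}_2^{q^{n^2}}(\mathcal A)$, and $$T_n\bigl(\mathrm{Trace}\,A_1A_2\cdots A_k\bigr)=\mathrm{Trace}\,A_1^{(n)}A_2^{(n)}\cdots A_k^{(n)}.$$ -/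

import Mathlib

/-- The `𝒜`-points of the quantum group `SL₂^q`: the `2 × 2` matrices `(a b; c d)` over the
`ℂ`-algebra `𝒜` whose entries satisfy the `q`-commutation relations and have quantum
determinant `1`. -/
def SL2qPoints (q : ℂ) (𝒜 : Type*) [Ring 𝒜] [Algebra ℂ 𝒜] : Set (Matrix (Fin 2) (Fin 2) 𝒜) :=
  {M | M 0 1 * M 0 0 = q • (M 0 0 * M 0 1) ∧
       M 1 1 * M 0 1 = q • (M 0 1 * M 1 1) ∧
       M 0 1 * M 1 0 = M 1 0 * M 0 1 ∧
       M 1 0 * M 0 0 = q • (M 0 0 * M 1 0) ∧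
       M 1 1 * M 1 0 = q • (M 1 0 * M 1 1) ∧
       M 0 0 * M 1 1 - q⁻¹ • (M 0 1 * M 1 0) = M 1 1 * M 0 0 - q • (M 0 1 * M 1 0) ∧
       M 0 0 * M 1 1 - q⁻¹ • (M 0 1 * M 1 0) = 1}

/-- The two shapes of a triangular `2 × 2` matrix. -/
inductive TriangularShape : Type
  | upper
  | lower

/-- The triangular matrix `(a b; 0 a⁻¹)` (shape `upper`) or `(a 0; b a⁻¹)` (shape `lower`),
for an invertible element `a` and an element `b` of `𝒜`. -/
def triangularMatrix {𝒜 : Type*} [Ring 𝒜] (s : TriangularShape) (a : 𝒜ˣ) (b : 𝒜) :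
    Matrix (Fin 2) (Fin 2) 𝒜 :=
  match s with
  | .upper => !![(a : 𝒜), b; 0, ((a⁻¹ : 𝒜ˣ) : 𝒜)]
  | .lower => !![(a : 𝒜), 0; b, ((a⁻¹ : 𝒜ˣ) : 𝒜)]

/-- The ordered product `M₁ M₂ ⋯ M_k` of `2 × 2` matrices over a (noncommutative) ring. -/
def orderedProduct {𝒜 : Type*} [Ring 𝒜] {k : ℕ} (M : Fin k → Matrix (Fin 2) (Fin 2) 𝒜) :
    Matrix (Fin 2) (Fin 2) 𝒜 :=
  (List.ofFn M).prod

/-!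
The proof passes through the entrywise `n`-th power `M ↦ M.map (· ^ n)`, and has two independent
ingredients, both of which come from one identity. Put `p = q ^ 2`, a primitive `n`-th root of
unity. If `y * x = p x * y + (1 - p) e` with `e` a scalar, the normally ordered sums
`h m = ∑ [m choose i]_p x ^ i * y ^ (m - i)` satisfy
`(x + y) * h (m + 1) = h (m + 2) + (1 - p ^ (m + 1)) e h m` (`add_mul_gaussBinomSum`), while
`h n = x ^ n + y ^ n`, because the intermediate Gaussian binomial coefficients vanish.

* For `e = 0` this is the `p`-binomial theorem `(x + y) ^ n = x ^ n + y ^ n`. Each entry of a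
  product `M * N` of points of `SL₂^q` with mutually commuting entries is a sum `x + y` with
  `y * x = p x * y`; hence entrywise `n`-th powers are multiplicative (`map_pow_mul`).
* For `e = 1` it says that `h m` is the value at `x + y` of a polynomial depending only on `p` and
  `m`, the continuous `p`-Hermite polynomial. The commuting pair `x = z`, `y = z⁻¹` in `ℂ` satisfies
  the hypothesis for every `p`, which shows that the `n`-th such polynomial takes the value
  `z ^ n + z⁻¹ ^ n` at `z + z⁻¹` and so is the Chebyshev polynomial `T_n`
  (`qHermite_eq_chebyshev`). The diagonal entries of a point `(a b; c d)` of `SL₂^q` satisfy the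
  hypothesis too, whence `T_n (a + d) = a ^ n + d ^ n` (`aeval_chebyshev_trace`).

Since `SL₂^q` is closed under products of matrices with mutually commuting entries
(`mul_mem_SL2qPoints`), the second point applies to `A₁ ⋯ A_k`, and the first identifies
`a ^ n + d ^ n` with the trace of `A₁⁽ⁿ⁾ ⋯ A_k⁽ⁿ⁾`.
-/

/-! ### Gaussian binomial coefficients -/

/-- The Gaussian binomial coefficient `[n choose k]_p`, defined by the `p`-Pascal recursion. -/
def gaussBinom {R : Type*} [CommRing R] (p : R) : ℕ → ℕ → R
  | _, 0 => 1
  | 0, _ + 1 => 0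
  | n + 1, k + 1 => gaussBinom p n k + p ^ (k + 1) * gaussBinom p n (k + 1)

section GaussBinom

variable {R : Type*} [CommRing R] (p : R)

theorem gaussBinom_zero_right (n : ℕ) : gaussBinom p n 0 = 1 := by
  cases n <;> rfl

theorem gaussBinom_succ_succ (n k : ℕ) : gaussBinom p (n + 1) (k + 1) =
    gaussBinom p n k + p ^ (k + 1) * gaussBinom p n (k + 1) := rfl

theorem gaussBinom_eq_zero_of_lt {n k : ℕ} (h : n < k) : gaussBinom p n k = 0 := by
  induction n generalizing k with
  | zero => cases k with
    | zero => omega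
    | succ k => rfl
  | succ n ih => cases k with
    | zero => omega
    | succ k => rw [gaussBinom_succ_succ, ih (by omega), ih (by omega)]; ring

theorem gaussBinom_self (n : ℕ) : gaussBinom p n n = 1 := by
  induction n with
  | zero => rfl
  | succ n ih => rw [gaussBinom_succ_succ, ih, gaussBinom_eq_zero_of_lt p n.lt_succ_self]; ring

/-- The `p`-analogue of the absorption identity `(k + 1) * (n + 1).choose (k + 1) =
(n + 1) * n.choose k`. -/
theorem gaussBinom_absorption (n k : ℕ) :
    (1 - p ^ (k + 1)) * gaussBinom p (n + 1) (k + 1) = (1 - p ^ (n + 1)) * gaussBinom p n k := by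
  induction n generalizing k with
  | zero => cases k with
    | zero => simp [gaussBinom]
    | succ k => simp [gaussBinom]
  | succ m ih => cases k with
    | zero =>
      rw [gaussBinom_succ_succ, gaussBinom_zero_right]
      have h := ih 0
      rw [gaussBinom_zero_right] at h
      linear_combination p * h
    | succ k =>
      rw [gaussBinom_succ_succ]
      linear_combination p ^ (k + 2) * ih (k + 1) + p * ih k
        - p * (1 - p ^ (m + 1)) * gaussBinom_succ_succ p m k

theorem gaussBinom_eq_zero_of_isPrimitiveRoot [IsDomain R] {n k : ℕ} (hp : IsPrimitiveRoot p n)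
    (hk : k ≠ 0) (hkn : k < n) : gaussBinom p n k = 0 := by
  obtain ⟨k, rfl⟩ := Nat.exists_eq_succ_of_ne_zero hk
  obtain ⟨n, rfl⟩ := Nat.exists_eq_succ_of_ne_zero (show n ≠ 0 by omega)
  have h := gaussBinom_absorption p n k
  rw [hp.pow_eq_one, sub_self, zero_mul] at h
  exact (mul_eq_zero.mp h).resolve_left (sub_ne_zero.mpr (hp.pow_ne_one_of_pos_of_lt hk hkn).symm)

end GaussBinom

/-! ### Normally ordered binomial sums -/

open Finset.HasAntidiagonal (antidiagonal mem_antidiagonal)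

/-- The normally ordered binomial sum `∑ [n choose i]_p x ^ i * y ^ (n - i)`, whose index runs over
the pairs `(i, j)` with `i + j = n`. -/
def gaussBinomSum {R A : Type*} [CommRing R] [Ring A] [Algebra R A] (p : R) (x y : A) (n : ℕ) : A :=
  ∑ ij ∈ antidiagonal n, gaussBinom p n ij.1 • (x ^ ij.1 * y ^ ij.2)

section GaussSum

variable {R A : Type*} [CommRing R] [Ring A] [Algebra R A] {p e : R} {x y : A}

theorem gaussBinomSum_zero : gaussBinomSum p x y 0 = 1 := by
  simp [gaussBinomSum, gaussBinom_zero_right]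

theorem gaussBinomSum_one : gaussBinomSum p x y 1 = x + y := by
  simp [gaussBinomSum, Finset.Nat.antidiagonal_succ, gaussBinom, add_comm]

/-- At a primitive `n`-th root of unity all the intermediate terms of the sum vanish. -/
theorem gaussBinomSum_of_isPrimitiveRoot [IsDomain R] {n : ℕ} (hn : 0 < n)
    (hp : IsPrimitiveRoot p n) : gaussBinomSum p x y n = x ^ n + y ^ n := by
  obtain ⟨m, rfl⟩ := Nat.exists_eq_succ_of_ne_zero hn.ne'
  rw [gaussBinomSum, Finset.sum_eq_add_of_mem (0, m + 1) (m + 1, 0) (by simp) (by simp) (by simp)]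
  · simp [gaussBinom_zero_right, gaussBinom_self, add_comm]
  · rintro ⟨i, j⟩ hij ⟨h0, h1⟩
    rw [mem_antidiagonal] at hij
    rw [gaussBinom_eq_zero_of_isPrimitiveRoot p hp, zero_smul]
    · rintro rfl
      exact h0 (by simpa using hij)
    · by_contra hlt
      exact h1 (Prod.ext (by simp at *; omega) (by simp at *; omega))

/-- Normal ordering of `y * x ^ (i + 1)`. The scalar is written `(1 - p) * e` so that the correction
term acquires the factor `1 - p ^ (i + 1)` of the absorption identity. -/
theorem mul_pow_of_mul_eq (h : y * x = p • (x * y) + ((1 - p) * e) • (1 : A)) (i : ℕ) :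
    y * x ^ (i + 1) = p ^ (i + 1) • (x ^ (i + 1) * y) + ((1 - p ^ (i + 1)) * e) • x ^ i := by
  induction i with
  | zero => simpa using h
  | succ i ih =>
    rw [pow_succ x (i + 1), ← mul_assoc, ih, add_mul, smul_mul_assoc, mul_assoc, h, smul_mul_assoc,
      ← pow_succ, mul_add, mul_smul_comm, mul_smul_comm, mul_one, ← mul_assoc]
    module

/-- If `y * x = p x * y + (1 - p) e`, the normally ordered sums satisfy the three-term recursion
of the continuous `q`-Hermite polynomials in the variable `x + y`. -/
theorem add_mul_gaussBinomSum (h : y * x = p • (x * y) + ((1 - p) * e) • (1 : A)) (n : ℕ) :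
    (x + y) * gaussBinomSum p x y (n + 1) =
      gaussBinomSum p x y (n + 2) + ((1 - p ^ (n + 1)) * e) • gaussBinomSum p x y n := by
  have hx : x * gaussBinomSum p x y (n + 1) = ∑ ij ∈ antidiagonal (n + 1),
      gaussBinom p (n + 1) ij.1 • (x ^ (ij.1 + 1) * y ^ ij.2) := by
    simp_rw [gaussBinomSum, Finset.mul_sum, mul_smul_comm, ← mul_assoc, ← pow_succ']
  have hy : y * gaussBinomSum p x y (n + 1) =
      ∑ ij ∈ antidiagonal (n + 1),
        (p ^ ij.1 * gaussBinom p (n + 1) ij.1) • (x ^ ij.1 * y ^ (ij.2 + 1)) +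
      ((1 - p ^ (n + 1)) * e) • gaussBinomSum p x y n := by
    have hterm (i j : ℕ) : y * (gaussBinom p (n + 1) (i + 1) • (x ^ (i + 1) * y ^ j)) =
        (p ^ (i + 1) * gaussBinom p (n + 1) (i + 1)) • (x ^ (i + 1) * y ^ (j + 1)) +
          ((1 - p ^ (n + 1)) * e) • gaussBinom p n i • (x ^ i * y ^ j) := by
      rw [mul_smul_comm, ← mul_assoc, mul_pow_of_mul_eq h, add_mul, smul_mul_assoc, smul_mul_assoc,
        mul_assoc, ← pow_succ', smul_add, smul_smul, smul_smul, smul_smul]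
      congr 2
      · ring
      · linear_combination e * gaussBinom_absorption p n i
    rw [gaussBinomSum, Finset.mul_sum, Finset.Nat.sum_antidiagonal_succ, gaussBinomSum, Finset.smul_sum,
      Finset.Nat.sum_antidiagonal_succ]
    simp_rw [hterm, Finset.sum_add_distrib]
    simp [gaussBinom_zero_right, pow_succ', add_assoc]
  have hsum : gaussBinomSum p x y (n + 2) =
      ∑ ij ∈ antidiagonal (n + 1),
        gaussBinom p (n + 1) ij.1 • (x ^ (ij.1 + 1) * y ^ ij.2) +
      ∑ ij ∈ antidiagonal (n + 1),
        (p ^ ij.1 * gaussBinom p (n + 1) ij.1) • (x ^ ij.1 * y ^ (ij.2 + 1)) := by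
    -- The last sum is one over `antidiagonal (n + 2)` whose term at `(n + 2, 0)` vanishes.
    have hlast : ∑ ij ∈ antidiagonal (n + 1),
        (p ^ ij.1 * gaussBinom p (n + 1) ij.1) • (x ^ ij.1 * y ^ (ij.2 + 1)) =
        ∑ ij ∈ antidiagonal (n + 2),
          (p ^ ij.1 * gaussBinom p (n + 1) ij.1) • (x ^ ij.1 * y ^ ij.2) := by
      rw [Finset.Nat.sum_antidiagonal_succ' (n := n + 1),
        gaussBinom_eq_zero_of_lt p (Nat.lt_succ_self (n + 1))]
      simp
    rw [hlast, gaussBinomSum, Finset.Nat.sum_antidiagonal_succ (n := n + 1),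
      Finset.Nat.sum_antidiagonal_succ (n := n + 1)]
    simp_rw [gaussBinom_succ_succ p (n + 1), add_smul, Finset.sum_add_distrib, gaussBinom_zero_right]
    simp only [pow_zero, one_mul]
    abel
  rw [add_mul, hx, hy, hsum, add_assoc]

/-- The `p`-binomial theorem at a primitive `n`-th root of unity. -/
theorem add_pow_of_isPrimitiveRoot [IsDomain R] {n : ℕ} (hn : 0 < n) (hp : IsPrimitiveRoot p n)
    (h : y * x = p • (x * y)) : (x + y) ^ n = x ^ n + y ^ n := by
  have key (m : ℕ) : (x + y) ^ m = gaussBinomSum p x y m := by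
    induction m with
    | zero => rw [pow_zero, gaussBinomSum_zero]
    | succ m ih => cases m with
      | zero => rw [pow_one, gaussBinomSum_one]
      | succ m =>
        rw [pow_succ', ih, add_mul_gaussBinomSum (e := 0) (by simpa using h)]
        simp
  rw [key, gaussBinomSum_of_isPrimitiveRoot hn hp]

end GaussSum

/-! ### Continuous `p`-Hermite polynomials and Chebyshev polynomials -/

/-- The continuous `p`-Hermite polynomials, normalized to be monic and with variable `2 cos θ`
instead of `cos θ`. -/
noncomputable def qHermite {R : Type*} [CommRing R] (p : R) : ℕ → Polynomial R
  | 0 => 1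
  | 1 => Polynomial.X
  | n + 2 => Polynomial.X * qHermite p (n + 1) - Polynomial.C (1 - p ^ (n + 1)) * qHermite p n

theorem aeval_qHermite {R A : Type*} [CommRing R] [Ring A] [Algebra R A] {p : R} {x y : A}
    (h : y * x = p • (x * y) + (1 - p) • (1 : A)) (n : ℕ) :
    Polynomial.aeval (x + y) (qHermite p n) = gaussBinomSum p x y n := by
  induction n using Nat.twoStepInduction with
  | zero => simp [qHermite, gaussBinomSum_zero]
  | one => simp [qHermite, gaussBinomSum_one]
  | more n ih₀ ih₁ =>
    rw [qHermite, map_sub, map_mul, map_mul, Polynomial.aeval_X, Polynomial.aeval_C, ih₀, ih₁,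
      add_mul_gaussBinomSum (e := 1) (by simpa using h), ← Algebra.smul_def, mul_one, add_sub_cancel_right]

theorem Complex.exists_add_inv_eq (t : ℂ) : ∃ z : ℂ, z ≠ 0 ∧ z + z⁻¹ = t := by
  obtain ⟨θ, hθ⟩ := Complex.cos_surjective (t / 2)
  refine ⟨Complex.exp (θ * Complex.I), Complex.exp_ne_zero _, ?_⟩
  rw [← Complex.exp_neg, ← neg_mul]
  rw [Complex.cos] at hθ
  linear_combination 2 * hθ

/-- At a primitive `n`-th root of unity, the `n`-th `p`-Hermite polynomial is the Chebyshev
polynomial: both take the value `z ^ n + z⁻¹ ^ n` at `z + z⁻¹`. -/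
theorem qHermite_eq_chebyshev {p : ℂ} {n : ℕ} (hn : 0 < n) (hp : IsPrimitiveRoot p n) :
    qHermite p n = Polynomial.Chebyshev.C ℂ n := by
  refine Polynomial.funext fun t => ?_
  obtain ⟨z, hz, rfl⟩ := Complex.exists_add_inv_eq t
  rw [← Polynomial.dickson_one_one_eq_chebyshev_C,
    Polynomial.dickson_one_one_eval_add_inv z z⁻¹ (mul_inv_cancel₀ hz), ← Polynomial.coe_aeval_eq_eval,
    aeval_qHermite (by simp [hz]), gaussBinomSum_of_isPrimitiveRoot hn hp]

/-! ### Points of `SL₂^q` -/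

theorem commute_orderedProduct {𝒜 : Type*} [Ring 𝒜] {k : ℕ}
    {M : Fin k → Matrix (Fin 2) (Fin 2) 𝒜} {x : 𝒜}
    (h : ∀ m i j, Commute x (M m i j)) (i j : Fin 2) : Commute x (orderedProduct M i j) := by
  induction k generalizing i j with
  | zero =>
    simp only [orderedProduct, List.ofFn_zero, List.prod_nil, Matrix.one_apply]
    split_ifs
    · exact Commute.one_right x
    · exact Commute.zero_right x
  | succ k ih =>
    have hrec (i j : Fin 2) := ih (M := fun m => M m.succ) (fun m => h m.succ) i j
    simp only [orderedProduct] at hrec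
    simp only [orderedProduct, List.ofFn_succ, List.prod_cons, Matrix.mul_apply, Fin.sum_univ_two]
    exact ((h _ _ _).mul_right (hrec _ _)).add_right ((h _ _ _).mul_right (hrec _ _))

section SL2q

variable {𝒜 : Type*} [Ring 𝒜] [Algebra ℂ 𝒜] {q : ℂ}

/-- In a point `(a b; c d)` of `SL₂^q`, the diagonal entries satisfy the `q`-oscillator relation
`d * a = q² a * d + (1 - q²)`, so that `T_n (a + d) = a ^ n + d ^ n`. -/
theorem aeval_chebyshev_trace {M : Matrix (Fin 2) (Fin 2) 𝒜} (hM : M ∈ SL2qPoints q 𝒜)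
    (hq : q ≠ 0) {n : ℕ} (hn : 0 < n) (hp : IsPrimitiveRoot (q ^ 2) n) :
    Polynomial.aeval M.trace (Polynomial.Chebyshev.C ℤ n) = M 0 0 ^ n + M 1 1 ^ n := by
  obtain ⟨-, -, -, -, -, h₁, h₂⟩ := hM
  have h : M 1 1 * M 0 0 = q ^ 2 • (M 0 0 * M 1 1) + (1 - q ^ 2) • (1 : 𝒜) := by
    have h₃ : M 1 1 * M 0 0 = 1 + q • (M 0 1 * M 1 0) := by rw [← h₂, h₁]; abel
    have h₄ : M 0 0 * M 1 1 = 1 + q⁻¹ • (M 0 1 * M 1 0) := by rw [← h₂]; abel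
    rw [h₃, h₄, smul_add, smul_smul, show q ^ 2 * q⁻¹ = q by field_simp]
    module
  rw [Matrix.trace_fin_two, ← gaussBinomSum_of_isPrimitiveRoot hn hp, ← aeval_qHermite h,
    qHermite_eq_chebyshev hn hp, ← Polynomial.Chebyshev.map_C (algebraMap ℤ ℂ),
    Polynomial.aeval_map_algebraMap]

theorem mul_inv_of_mul_eq {a : 𝒜ˣ} {b : 𝒜} (h : b * a = q • (a * b)) :
    (↑a⁻¹ : 𝒜) * b = q • (b * ↑a⁻¹) := by
  rw [Units.inv_mul_eq_iff_eq_mul, mul_smul_comm, ← mul_assoc, ← smul_mul_assoc, ← h,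
    Units.mul_inv_cancel_right]

theorem triangularMatrix_mem (s : TriangularShape) {a : 𝒜ˣ} {b : 𝒜} (h : b * a = q • (a * b)) :
    triangularMatrix s a b ∈ SL2qPoints q 𝒜 := by
  have h' := mul_inv_of_mul_eq h
  cases s <;> simp [triangularMatrix, SL2qPoints, h, h']

theorem pow_mul_pow_of_mul_eq {a b : 𝒜} (h : b * a = q • (a * b)) (n : ℕ) :
    b ^ n * a ^ n = q ^ (n ^ 2) • (a ^ n * b ^ n) := by
  have h₁ (m : ℕ) : b * a ^ m = q ^ m • (a ^ m * b) := by
    cases m with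
    | zero => simp
    | succ m => simpa using mul_pow_of_mul_eq (p := q) (e := 0) (x := a) (y := b) (by simpa using h) m
  have h₂ (m : ℕ) : b ^ m * a ^ n = q ^ (m * n) • (a ^ n * b ^ m) := by
    induction m with
    | zero => simp
    | succ m ih =>
      rw [pow_succ, mul_assoc, h₁, mul_smul_comm, ← mul_assoc, ih, smul_mul_assoc, smul_smul,
        mul_assoc]
      congr 1
      ring
  rw [h₂, sq]

/-- The quantum group law: `SL₂^q` is closed under products of two points such that each entry of
one commutes with each entry of the other. -/
theorem mul_mem_SL2qPoints {M N : Matrix (Fin 2) (Fin 2) 𝒜} (hq : q ≠ 0) (hM : M ∈ SL2qPoints q 𝒜)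
    (hN : N ∈ SL2qPoints q 𝒜) (hMN : ∀ i j k l, Commute (M i j) (N k l)) :
    M * N ∈ SL2qPoints q 𝒜 := by
  obtain ⟨m₁, m₂, m₃, m₄, m₅, m₆, m₇⟩ := hM
  obtain ⟨n₁, n₂, n₃, n₄, n₅, n₆, n₇⟩ := hN
  have m₈ : M 1 1 * M 0 0 = 1 + q • (M 0 1 * M 1 0) := by rw [← m₇, m₆]; abel
  have m₉ : M 0 0 * M 1 1 = 1 + q⁻¹ • (M 0 1 * M 1 0) := by rw [← m₇]; abel
  have n₈ : N 1 1 * N 0 0 = 1 + q • (N 0 1 * N 1 0) := by rw [← n₇, n₆]; abel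
  have n₉ : N 0 0 * N 1 1 = 1 + q⁻¹ • (N 0 1 * N 1 0) := by rw [← n₇]; abel
  have hswap (i j k l : Fin 2) (u v : 𝒜) : u * N k l * (M i j * v) = u * M i j * (N k l * v) :=
    (hMN i j k l).symm.mul_mul_mul_comm u v
  -- These rules bring every monomial into the form `(ordered word in M) * (ordered word in N)`.
  refine ⟨?_, ?_, ?_, ?_, ?_, ?_, ?_⟩ <;>
    simp only [Matrix.mul_apply, Fin.sum_univ_two, mul_add, add_mul, hswap, m₁, m₂, m₄, m₅, m₈, m₉,
      n₁, n₂, n₄, n₅, n₈, n₉, ← m₃, ← n₃, smul_mul_assoc, mul_smul_comm, mul_one, one_mul] <;>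
    match_scalars <;> field_simp <;> ring

/-- At a primitive root of unity, raising the entries to the `n`-th power is compatible with the
quantum group law (the quantum Frobenius map). -/
theorem map_pow_mul {M N : Matrix (Fin 2) (Fin 2) 𝒜} (hM : M ∈ SL2qPoints q 𝒜)
    (hN : N ∈ SL2qPoints q 𝒜) (hMN : ∀ i j k l, Commute (M i j) (N k l)) {n : ℕ} (hn : 0 < n)
    (hp : IsPrimitiveRoot (q ^ 2) n) :
    (M * N).map (· ^ n) = M.map (· ^ n) * N.map (· ^ n) := by
  obtain ⟨m₁, m₂, -, m₃, m₄, -⟩ := hM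
  obtain ⟨n₁, n₂, -, n₃, n₄, -⟩ := hN
  have hrow (i : Fin 2) : M i 1 * M i 0 = q • (M i 0 * M i 1) := by
    fin_cases i <;> assumption
  have hcol (j : Fin 2) : N 1 j * N 0 j = q • (N 0 j * N 1 j) := by
    fin_cases j <;> assumption
  ext i j
  simp only [Matrix.map_apply, Matrix.mul_apply, Fin.sum_univ_two]
  -- The first rewrite leaves the relation `y * x = q ^ 2 x * y` between the two terms of an entry.
  rw [add_pow_of_isPrimitiveRoot hn hp, (hMN _ _ _ _).mul_pow, (hMN _ _ _ _).mul_pow]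
  rw [(hMN i 0 1 j).symm.mul_mul_mul_comm, (hMN i 1 0 j).symm.mul_mul_mul_comm, hrow, hcol,
    smul_mul_smul_comm, sq]

theorem one_mem_SL2qPoints : (1 : Matrix (Fin 2) (Fin 2) 𝒜) ∈ SL2qPoints q 𝒜 := by
  simp [SL2qPoints]

theorem orderedProduct_mem_and_map_pow (hq : q ≠ 0) {n : ℕ} (hn : 0 < n)
    (hp : IsPrimitiveRoot (q ^ 2) n) {k : ℕ} {M : Fin k → Matrix (Fin 2) (Fin 2) 𝒜}
    (hM : ∀ m, M m ∈ SL2qPoints q 𝒜)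
    (hcomm : ∀ m m', m ≠ m' → ∀ i j i' j', Commute (M m i j) (M m' i' j')) :
    orderedProduct M ∈ SL2qPoints q 𝒜 ∧
      (orderedProduct M).map (· ^ n) = orderedProduct fun m => (M m).map (· ^ n) := by
  induction k with
  | zero =>
    refine ⟨by simpa [orderedProduct] using one_mem_SL2qPoints, ?_⟩
    simpa [orderedProduct] using Matrix.map_one (· ^ n) (zero_pow hn.ne') (one_pow n)
  | succ k ih =>
    obtain ⟨hmem, hpow⟩ := ih (M := fun m => M m.succ) (fun m => hM m.succ)
      (fun m m' hm => hcomm _ _ (by simpa using hm))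
    have hc (i j i' j' : Fin 2) :
        Commute (M 0 i j) (orderedProduct (fun m => M m.succ) i' j') :=
      commute_orderedProduct (fun m => hcomm 0 m.succ (Fin.succ_ne_zero m).symm i j) i' j'
    have hsucc (M : Fin (k + 1) → Matrix (Fin 2) (Fin 2) 𝒜) :
        orderedProduct M = M 0 * orderedProduct fun m => M m.succ := by
      simp [orderedProduct]
    rw [hsucc M, hsucc fun m => (M m).map (· ^ n), ← hpow]
    exact ⟨mul_mem_SL2qPoints hq (hM 0) hmem hc, map_pow_mul (hM 0) hmem hc hn hp⟩

end SL2q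

/-! ### Products of triangular matrices -/

theorem triangularMatrix_map_pow {𝒜 : Type*} [Ring 𝒜] (s : TriangularShape) (a : 𝒜ˣ) (b : 𝒜)
    {n : ℕ} (hn : 0 < n) :
    (triangularMatrix s a b).map (· ^ n) = triangularMatrix s (a ^ n) (b ^ n) := by
  cases s <;> ext i j <;> fin_cases i <;> fin_cases j <;>
    simp [triangularMatrix, zero_pow hn.ne', Units.val_pow_eq_pow_val]

theorem triangularMatrix_apply_commute {𝒜 : Type*} [Ring 𝒜] (s : TriangularShape) {a : 𝒜ˣ}
    {b x : 𝒜} (ha : Commute x a) (hb : Commute x b) (i j : Fin 2) :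
    Commute x (triangularMatrix s a b i j) := by
  cases s <;> fin_cases i <;> fin_cases j <;>
    simp [triangularMatrix, ha, hb, ha.units_inv_right]

theorem theorem1 {𝒜 : Type*} [Ring 𝒜] [Algebra ℂ 𝒜]
    (q : ℂ) (hq : q ≠ 0) (n : ℕ) (hn : 0 < n) (hprim : IsPrimitiveRoot (q ^ 2) n)
    (k : ℕ) (s : Fin k → TriangularShape) (a : Fin k → 𝒜ˣ) (b : Fin k → 𝒜)
    (hba : ∀ i, b i * (a i : 𝒜) = q • ((a i : 𝒜) * b i))
    (hcomm : ∀ i j, i ≠ j →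
      Commute (a i : 𝒜) (a j : 𝒜) ∧ Commute (a i : 𝒜) (b j) ∧
      Commute (b i) (a j : 𝒜) ∧ Commute (b i) (b j)) :
    (∀ i, triangularMatrix (s i) (a i) (b i) ∈ SL2qPoints q 𝒜) ∧
    orderedProduct (fun i => triangularMatrix (s i) (a i) (b i)) ∈ SL2qPoints q 𝒜 ∧
    (∀ i, triangularMatrix (s i) (a i ^ n) (b i ^ n) ∈ SL2qPoints (q ^ (n ^ 2)) 𝒜) ∧
    Polynomial.aeval
        (Matrix.trace (orderedProduct (fun i => triangularMatrix (s i) (a i) (b i))))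
        (Polynomial.Chebyshev.C ℤ (n : ℤ)) =
      Matrix.trace (orderedProduct (fun i => triangularMatrix (s i) (a i ^ n) (b i ^ n))) := by
  have hmem (i : Fin k) := triangularMatrix_mem (s i) (hba i)
  have hc (i j : Fin k) (hij : i ≠ j) (u v u' v' : Fin 2) :
      Commute (triangularMatrix (s i) (a i) (b i) u v)
        (triangularMatrix (s j) (a j) (b j) u' v') := by
    obtain ⟨haa, hab, hb_a, hbb⟩ := hcomm i j hij
    exact triangularMatrix_apply_commute _
      (triangularMatrix_apply_commute _ haa.symm hb_a.symm _ _).symm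
      (triangularMatrix_apply_commute _ hab.symm hbb.symm _ _).symm _ _
  obtain ⟨hprod, hpow⟩ := orderedProduct_mem_and_map_pow hq hn hprim hmem hc
  refine ⟨hmem, hprod, fun i => triangularMatrix_mem (s i) ?_, ?_⟩
  · simpa using pow_mul_pow_of_mul_eq (hba i) n
  · simp_rw [triangularMatrix_map_pow _ _ _ hn] at hpow
    rw [aeval_chebyshev_trace hprod hq hn hprim, ← hpow, Matrix.trace_fin_two]
    rfl
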